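/- Let $k$ be an algebraically closed field. For a $k$-variety $X$ (separated, of finite type over $k$) let $K_0(\mathrm{Var}/X)$ be the Grothendieck ring of varieties over $X$, generated by isomorphism classes $[Y\to X]$ with $[Y]=[Z]+[U]$ for $Z\subseteq Y$ closed with open complement $U$, and with product the fibre product over $X$; write $K_0(\mathrm{Var}_k)=K_0(\mathrm{Var}/\operatorname{Spec}k)$, with unit $\star=[\operatorname{Spec} k]$. For a morphism $f\colon X\to X'$ of varieties let $f^*\colon K_0(\mathrm{Var}/X')\to K_0(\mathrm{Var}/X)$ be base change and $f_!\colon K_0(\mathrm{Var}/X)\to K_0(\mathrm{Var}/X')$ be composition with $f$. Let $G$ be an algebraic group over $k$ (a reduced variety with a group structure), let $g,s\ge 0$, let $\lambda_1,\dots,\lambda_s\subseteq G$ be locally closed subvarieties that are closed under conjugation, and let $\epsilon_1,\dots,\epsilon_s\in\{1,-1\}$. Let $\Sigma_g$ be the closed oriented surface of genus $g$ and let $Q$ be the parabolic structure on it given by $s$ marked points with data $\lambda_1,\dots,\lambda_s$, each marked point with an orientation of a small disc around it, where $\epsilon_j=1$ if the orientation at the $j$-th point agrees with that of $\Sigma_g$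 and $\epsilon_j=-1$ otherwise. In terms of the standard presentation $$\Big\langle \alpha_1,\beta_1,\dots,\alpha_g,\beta_g,\gamma_1,\dots,\gamma_s \ \Big|\ \prod_{i=1}^g[\alpha_i,\beta_i]\prod_{j=1}^s\gamma_j=1\Big\rangle$$ of the fundamental group of $\Sigma_g$ without the marked points, with meridians $\gamma_j^{\epsilon_j}$, the variety $\mathfrak X_G(\Sigma_g,Q)$ of representations $\rho$ with $\rho(\gamma_j^{\epsilon_j})\in\lambda_j$ is $$\mathfrak X_G(\Sigma_g,Q)=\Big\{(A_1,B_1,\dots,A_g,B_g,C_1,\dots,C_s)\in G^{2g+s}\ \Big|\ \prod_{i=1}^g[A_i,B_i]\prod_{j=1}^sC_j=1,\ C_j^{\epsilon_j}\in\lambda_j\Big\}.$$ Let $i\colon 1\hookrightarrow G$ be the inclusion of the unit, and put - $Z(D)=i_!\colon K_0(\mathrm{Var}_k)\to K_0(\mathrm{Var}/G)$ and $Z(D^\dagger)=i^*\colon K_0(\mathrm{Var}/G)\to K_0(\mathrm{Var}_k)$; - $Z(L)=q_!\,p^*$ on $K_0(\mathrm{Var}/G)$, where $p,q\colon G^4\to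 G$ are $p(x,a,b,h)=x$ and $q(x,a,b,h)=h\,x\,[a,b]\,h^{-1}$; - $Z(L_{\lambda_j})=t_!\,r^*$ on $K_0(\mathrm{Var}/G)$, where $r,t\colon G^2\times\lambda_j\to G$ are $r(x,h,\xi)=x$ and $t(x,h,\xi)=h\,x\,\xi^{\epsilon_j}h^{-1}$. Then, in $K_0(\mathrm{Var}_k)$, $$[G]^{g+s}\cdot[\mathfrak X_G(\Sigma_g,Q)]=Z(D^\dagger)\circ Z(L_{\lambda_s})\circ\cdots\circ Z(L_{\lambda_1})\circ Z(L)^g\circ Z(D)(\star),$$ and hence, in the localization $K_0(\mathrm{Var}_k)\big[[G]^{-1}\big]$, $$[\mathfrak X_G(\Sigma_g,Q)]=\frac{1}{[G]^{g+s}}\,Z(D^\dagger)\circ Z(L_{\lambda_s})\circ\cdots\circ Z(L_{\lambda_1})\circ Z(L)^g\circ Z(D)(\star).$$ -/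

import Mathlib

open CategoryTheory Limits MonoidalCategory CartesianMonoidalCategory AlgebraicGeometry
open scoped MonObj

universe u

noncomputable section

namespace RepTQFT

/-! ### Varieties over a base and their Grothendieck rings -/

/-- Separated morphisms of finite type: the structure morphisms of varieties over a base. -/
def varMor : MorphismProperty Scheme.{u} := fun _ _ f =>
  IsSeparated f ∧ LocallyOfFiniteType f ∧ QuasiCompact f

instance : (varMor.{u}).IsStableUnderBaseChange where
  of_isPullback sq h :=
    ⟨MorphismProperty.of_isPullback (P := @IsSeparated) sq h.1,
      MorphismProperty.of_isPullback (P := @LocallyOfFiniteType) sq h.2.1,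
      MorphismProperty.of_isPullback (P := @QuasiCompact) sq h.2.2⟩

instance : (varMor.{u}).IsMultiplicative where
  id_mem _ := ⟨inferInstance, inferInstance, inferInstance⟩
  comp_mem f g := by
    rintro ⟨_, _, _⟩ ⟨_, _, _⟩
    exact ⟨inferInstance, inferInstance, inferInstance⟩

lemma varMor_of_comp {X Y Z : Scheme.{u}} (f : X ⟶ Y) (g : Y ⟶ Z)
    (hfg : varMor (f ≫ g)) (hg : varMor g) : varMor f := by
  obtain ⟨_, _, _⟩ := hfg
  obtain ⟨_, _, _⟩ := hg
  exact ⟨IsSeparated.of_comp f g, locallyOfFiniteType_of_comp f g, QuasiCompact.of_comp f g⟩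

/-- Varieties over `S`: separated `S`-schemes of finite type. They need not be reduced; this does
not change the Grothendieck ring, where a scheme and its reduction have the same class. -/
abbrev VarOver (S : Scheme.{u}) : Type (u + 1) := {Y : Over S // varMor Y.hom}

/-- Being isomorphic over `S`. -/
instance isoSetoid (S : Scheme.{u}) : Setoid (VarOver S) where
  r Y Y' := Nonempty (Y.1 ≅ Y'.1)
  iseqv := ⟨fun _ => ⟨Iso.refl _⟩, fun ⟨e⟩ => ⟨e.symm⟩, fun ⟨e⟩ ⟨e'⟩ => ⟨e.trans e'⟩⟩

/-- Isomorphism classes of varieties over `S`. -/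
def IsoClass (S : Scheme.{u}) : Type (u + 1) := Quotient (isoSetoid S)

/-- The fibre product over `S`. -/
def VarOver.prod {S : Scheme.{u}} (Y Z : VarOver S) : VarOver S :=
  ⟨Y.1 ⊗ Z.1, by
    rw [Over.tensorObj_hom]
    exact varMor.comp_mem _ _ (varMor.pullback_fst _ _ Z.2) Y.2⟩

/-- `S` as a variety over itself. -/
def VarOver.unit (S : Scheme.{u}) : VarOver S := ⟨𝟙_ (Over S), varMor.id_mem S⟩

/-- Isomorphism classes form a commutative monoid under fibre product over `S`. -/
instance (S : Scheme.{u}) : CommMonoid (IsoClass S) where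
  mul := Quotient.map₂ VarOver.prod fun _ _ ⟨e⟩ _ _ ⟨e'⟩ => ⟨e ⊗ᵢ e'⟩
  one := Quotient.mk _ (VarOver.unit S)
  mul_assoc := by
    rintro ⟨a⟩ ⟨b⟩ ⟨c⟩
    exact Quotient.sound ⟨α_ a.1 b.1 c.1⟩
  one_mul := by
    rintro ⟨a⟩
    exact Quotient.sound ⟨λ_ a.1⟩
  mul_one := by
    rintro ⟨a⟩
    exact Quotient.sound ⟨ρ_ a.1⟩
  mul_comm := by
    rintro ⟨a⟩ ⟨b⟩
    exact Quotient.sound ⟨β_ a.1 b.1⟩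

/-- The generator attached to a variety over `S`. -/
def gen {S : Scheme.{u}} (Y : VarOver S) : FreeAbelianGroup (IsoClass S) :=
  FreeAbelianGroup.of (Quotient.mk _ Y)

lemma gen_mul {S : Scheme.{u}} (Y Z : VarOver S) : gen Y * gen Z = gen (Y.prod Z) :=
  FreeAbelianGroup.of_mul_of _ _

lemma gen_eq_of_iso {S : Scheme.{u}} {Y Z : VarOver S} (e : Y.1 ≅ Z.1) : gen Y = gen Z :=
  congrArg FreeAbelianGroup.of (Quotient.sound ⟨e⟩)

/-- `Y` is the disjoint union of the closed subvariety `Z` and the open subvariety `U`. -/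
structure Decomposition {S : Scheme.{u}} (Y Z U : VarOver S) where
  i : Z.1 ⟶ Y.1
  j : U.1 ⟶ Y.1
  closed : IsClosedImmersion i.left
  isOpen : IsOpenImmersion j.left
  compl : Set.range i.left = (Set.range j.left)ᶜ

/-- The cut-and-paste relations `[Y] = [Z] + [U]`. -/
def scissor (S : Scheme.{u}) : Set (FreeAbelianGroup (IsoClass S)) :=
  {x | ∃ Y Z U : VarOver S, Nonempty (Decomposition Y Z U) ∧ x = gen Y - gen Z - gen U}

/-- The Grothendieck ring of varieties over `S`, with product the fibre product over `S`. -/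
def K0 (S : Scheme.{u}) : Type (u + 1) :=
  FreeAbelianGroup (IsoClass S) ⧸ Ideal.span (scissor S)

instance (S : Scheme.{u}) : CommRing (K0 S) :=
  inferInstanceAs (CommRing (FreeAbelianGroup (IsoClass S) ⧸ Ideal.span (scissor S)))

/-- The quotient map onto the Grothendieck ring. -/
def K0.mk (S : Scheme.{u}) : FreeAbelianGroup (IsoClass S) →+* K0 S :=
  Ideal.Quotient.mk (Ideal.span (scissor S))

/-- The class `[Y] = [Y → S]`. -/
def K0.cls {S : Scheme.{u}} (Y : Over S) (hY : varMor Y.hom) : K0 S := K0.mk S (gen ⟨Y, hY⟩)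

/-! ### Pullback -/

/-- Base change of a variety over `T` along `h : S ⟶ T`. -/
def VarOver.pull {S T : Scheme.{u}} (h : S ⟶ T) (Y : VarOver T) : VarOver S :=
  ⟨(Over.pullback h).obj Y.1, varMor.pullback_snd _ _ Y.2⟩

/-- Base change on isomorphism classes; it preserves fibre products. -/
def pullClass {S T : Scheme.{u}} (h : S ⟶ T) : IsoClass T →* IsoClass S where
  toFun := Quotient.map (VarOver.pull h) fun _ _ ⟨e⟩ => ⟨(Over.pullback h).mapIso e⟩
  map_one' := Quotient.sound ⟨preservesTerminalIso (Over.pullback h)⟩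
  map_mul' := by
    rintro ⟨a⟩ ⟨b⟩
    exact Quotient.sound ⟨prodComparisonIso (Over.pullback h) a.1 b.1⟩

lemma range_of_isPullback {A B C D : Scheme.{u}} {f : A ⟶ B} {g : A ⟶ C} {i : B ⟶ D} {q : C ⟶ D}
    (h : IsPullback f g i q) : Set.range g = q ⁻¹' Set.range i := by
  have h1 := Scheme.Pullback.range_snd (f := i) (g := q)
  rw [← h1, ← h.isoPullback_hom_snd]
  ext x
  constructor
  · rintro ⟨y, rfl⟩
    exact ⟨h.isoPullback.hom y, by rw [← Scheme.Hom.comp_apply, h.isoPullback_hom_snd]⟩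
  · rintro ⟨y, rfl⟩
    exact ⟨h.isoPullback.inv y, by simp [← Scheme.Hom.comp_apply]⟩

/-- Decompositions are stable under base change. -/
def Decomposition.ofIsPullback {S T : Scheme.{u}} {Y Z U : VarOver T}
    (d : Decomposition Y Z U) {Y' Z' U' : VarOver S} (i' : Z'.1 ⟶ Y'.1) (j' : U'.1 ⟶ Y'.1)
    (p : Z'.1.left ⟶ Z.1.left) (q : Y'.1.left ⟶ Y.1.left) (r : U'.1.left ⟶ U.1.left)
    (hi : IsPullback p i'.left d.i.left q) (hj : IsPullback r j'.left d.j.left q) :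
    Decomposition Y' Z' U' where
  i := i'
  j := j'
  closed := MorphismProperty.of_isPullback (P := @IsClosedImmersion) hi d.closed
  isOpen := MorphismProperty.of_isPullback (P := @IsOpenImmersion) hj d.isOpen
  compl := by
    rw [range_of_isPullback hi, range_of_isPullback hj, d.compl, Set.preimage_compl]

lemma isPullback_pull {S T : Scheme.{u}} (h : S ⟶ T) {Z Y : Over T} (i : Z ⟶ Y) :
    IsPullback (pullback.fst Z.hom h) ((Over.pullback h).map i).left i.left
      (pullback.fst Y.hom h) := by
  refine IsPullback.flip (IsPullback.of_right (h₁₂ := pullback.snd Y.hom h) (h₂₂ := Y.hom)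
    (v₁₃ := h) ?_ ?_ (IsPullback.of_hasPullback Y.hom h).flip)
  · have h1 : ((Over.pullback h).map i).left ≫ pullback.snd Y.hom h = pullback.snd Z.hom h :=
      pullback.lift_snd _ _ _
    rw [h1, Over.w i]
    exact (IsPullback.of_hasPullback Z.hom h).flip
  · exact pullback.lift_fst _ _ _

lemma isPullback_prod {S : Scheme.{u}} (W : Over S) {Z Y : Over S} (i : Z ⟶ Y) :
    IsPullback (snd W Z).left (W ◁ i).left i.left (snd W Y).left := by
  refine IsPullback.flip (IsPullback.of_right (h₁₂ := (fst W Y).left) (h₂₂ := Y.hom)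
    (v₁₃ := W.hom) ?_ ?_ (IsPullback.of_hasPullback W.hom Y.hom))
  · have := IsPullback.of_hasPullback W.hom Z.hom
    simpa using this
  · simp

/-- The ideal of relations is preserved by additive maps which send, for every variety `W`, the
relations multiplied by `[W]` to zero. -/
lemma eq_zero_of_mem_span {S : Scheme.{u}} {A : Type*} [AddCommGroup A]
    (φ : FreeAbelianGroup (IsoClass S) →+ A)
    (hφ : ∀ (Y Z U : VarOver S), Decomposition Y Z U → φ (gen Y - gen Z - gen U) = 0)
    {x : FreeAbelianGroup (IsoClass S)} (hx : x ∈ Ideal.span (scissor S)) : φ x = 0 := by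
  suffices h : ∀ a, φ (a * x) = 0 by simpa using h 1
  induction hx using Submodule.span_induction with
  | mem x hx =>
    obtain ⟨Y, Z, U, ⟨d⟩, rfl⟩ := hx
    intro a
    induction a using FreeAbelianGroup.induction_on with
    | zero => simp
    | of w =>
      obtain ⟨W, rfl⟩ := Quotient.exists_rep w
      have := hφ _ _ _ (d.ofIsPullback (Y' := W.prod Y) (Z' := W.prod Z) (U' := W.prod U)
        (W.1 ◁ d.i) (W.1 ◁ d.j) _ _ _ (isPullback_prod W.1 d.i) (isPullback_prod W.1 d.j))
      rw [← gen_mul, ← gen_mul, ← gen_mul, ← mul_sub, ← mul_sub] at this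
      exact this
    | neg w h => rw [neg_mul, map_neg, h, neg_zero]
    | add a b ha hb => rw [add_mul, map_add, ha, hb, add_zero]
  | zero => simp
  | add x y _ _ hx hy => intro a; rw [mul_add, map_add, hx, hy, add_zero]
  | smul b x _ hx => intro a; rw [smul_eq_mul, ← _root_.mul_assoc]; exact hx _

lemma mk_eq_zero_of_decomposition {S : Scheme.{u}} {Y Z U : VarOver S} (d : Decomposition Y Z U) :
    K0.mk S (gen Y - gen Z - gen U) = 0 :=
  Ideal.Quotient.eq_zero_iff_mem.2 (Ideal.subset_span ⟨Y, Z, U, ⟨d⟩, rfl⟩)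

/-- The ring homomorphism `h^* : K0(Var/T) → K0(Var/S)` given by base change along `h : S ⟶ T`. -/
def pull {S T : Scheme.{u}} (h : S ⟶ T) : K0 T →+* K0 S :=
  Ideal.Quotient.lift (Ideal.span (scissor T))
    (FreeAbelianGroup.liftMonoid
      ((K0.mk S : FreeAbelianGroup (IsoClass S) →* K0 S).comp
        (FreeAbelianGroup.ofMulHom.comp (pullClass h))))
    fun x hx => by
      refine eq_zero_of_mem_span (A := K0 S) (AddMonoidHomClass.toAddMonoidHom
        (FreeAbelianGroup.liftMonoid _)) ?_ hx
      intro Y Z U d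
      have := mk_eq_zero_of_decomposition (d.ofIsPullback (Y' := Y.pull h) (Z' := Z.pull h)
        (U' := U.pull h) _ _ _ _ _ (isPullback_pull h d.i) (isPullback_pull h d.j))
      rw [map_sub, map_sub] at this ⊢
      exact (congrArg₂ (· - ·) (congrArg₂ (· - ·) (FreeAbelianGroup.lift_apply_of _ _)
        (FreeAbelianGroup.lift_apply_of _ _)) (FreeAbelianGroup.lift_apply_of _ _)).trans this

lemma pull_cls {S T : Scheme.{u}} (h : S ⟶ T) (Y : Over T) (hY : varMor Y.hom) :
    pull h (K0.cls Y hY) = K0.cls ((Over.pullback h).obj Y) (varMor.pullback_snd _ _ hY) := by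
  refine (Ideal.Quotient.lift_mk _ _ _).trans ?_
  exact (FreeAbelianGroup.lift_apply_of _ _)

/-! ### Push-forward -/

/-- A variety over `S`, seen over `T` by composing with `h : S ⟶ T`. -/
def VarOver.push {S T : Scheme.{u}} (h : S ⟶ T) (hh : varMor h) (Y : VarOver S) : VarOver T :=
  ⟨(Over.map h).obj Y.1, varMor.comp_mem _ _ Y.2 hh⟩

/-- Composition with `h` on isomorphism classes. -/
def pushClass {S T : Scheme.{u}} (h : S ⟶ T) (hh : varMor h) : IsoClass S → IsoClass T :=
  Quotient.map (VarOver.push h hh) fun _ _ ⟨e⟩ => ⟨(Over.map h).mapIso e⟩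

/-- The additive homomorphism `h_! : K0(Var/S) → K0(Var/T)` given by composition with `h`. -/
def push {S T : Scheme.{u}} (h : S ⟶ T) (hh : varMor h) : K0 S →+ K0 T :=
  QuotientAddGroup.lift (Ideal.span (scissor S)).toAddSubgroup
    (FreeAbelianGroup.lift fun y => K0.mk T (FreeAbelianGroup.of (pushClass h hh y)))
    fun x hx => by
      refine eq_zero_of_mem_span (A := K0 T) _ ?_ hx
      intro Y Z U d
      have := mk_eq_zero_of_decomposition (Y := Y.push h hh) (Z := Z.push h hh)
        (U := U.push h hh) ⟨(Over.map h).map d.i, (Over.map h).map d.j, d.closed, d.isOpen, d.compl⟩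
      rw [map_sub, map_sub] at this ⊢
      exact (congrArg₂ (· - ·) (congrArg₂ (· - ·) (FreeAbelianGroup.lift_apply_of _ _)
        (FreeAbelianGroup.lift_apply_of _ _)) (FreeAbelianGroup.lift_apply_of _ _)).trans this

lemma push_cls {S T : Scheme.{u}} (h : S ⟶ T) (hh : varMor h) (Y : Over S) (hY : varMor Y.hom) :
    push h hh (K0.cls Y hY) = K0.cls ((Over.map h).obj Y) (varMor.comp_mem _ _ hY hh) :=
  FreeAbelianGroup.lift_apply_of _ _

/-! ### Varieties over a fixed base, and push-pull along spans -/

/-- `X` is a variety over `S` (separated and of finite type). -/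
class IsVar {S : Scheme.{u}} (X : Over S) : Prop where
  out : varMor X.hom

/-- Being a variety over `S`, as a property of objects of `Over S`. -/
abbrev isVarProp (S : Scheme.{u}) : ObjectProperty (Over S) := fun X => IsVar X

instance (S : Scheme.{u}) : (isVarProp S).IsClosedUnderIsomorphisms where
  of_iso {X Y} e h := ⟨by
    have : IsIso e.inv.left := inferInstanceAs (IsIso ((Over.forget S).map e.inv))
    rw [← Over.w e.inv]
    exact varMor.comp_mem _ _ (varMor.of_isIso e.inv.left) h.out⟩

instance (S : Scheme.{u}) : IsVar (𝟙_ (Over S)) := ⟨varMor.id_mem S⟩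

instance {S : Scheme.{u}} (X Y : Over S) [hX : IsVar X] [hY : IsVar Y] : IsVar (X ⊗ Y) :=
  ⟨(VarOver.prod ⟨X, hX.out⟩ ⟨Y, hY.out⟩).2⟩

instance {S : Scheme.{u}} {I : Type} [Finite I] (X : I → Over S) [h : ∀ i, IsVar (X i)] :
    IsVar (∏ᶜ X) := by
  have h1 : (isVarProp S).IsClosedUnderLimitsOfShape (Discrete.{0} PEmpty) := ⟨by
    rintro Y ⟨p⟩
    have hY : IsTerminal Y := (IsLimit.equivOfNatIsoOfIso p.diag.uniqueFromEmpty _ _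
      (by exact Cone.ext (Iso.refl _) (by rintro ⟨⟨⟩⟩))).1 p.isLimit
    exact (isVarProp S).prop_of_iso (hY.uniqueUpToIso isTerminalTensorUnit).symm
      (inferInstanceAs (IsVar (𝟙_ (Over S))))⟩
  have h2 : (isVarProp S).IsClosedUnderBinaryProducts := ⟨by
    rintro Y ⟨p⟩
    have h1 : IsVar (p.diag.obj ⟨.left⟩) := p.prop_diag_obj ⟨.left⟩
    have h2 : IsVar (p.diag.obj ⟨.right⟩) := p.prop_diag_obj ⟨.right⟩
    exact (isVarProp S).prop_of_iso (IsLimit.conePointsIsoOfNatIso p.isLimit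
      (tensorProductIsBinaryProduct _ _) (diagramIsoPair p.diag)).symm
      (inferInstanceAs (IsVar (p.diag.obj ⟨.left⟩ ⊗ p.diag.obj ⟨.right⟩)))⟩
  have := ObjectProperty.IsClosedUnderFiniteProducts.mk' (P := isVarProp S)
  exact (isVarProp S).prop_product h

lemma varMor_left {S : Scheme.{u}} {X Y : Over S} [hX : IsVar X] [hY : IsVar Y] (f : X ⟶ Y) :
    varMor f.left :=
  varMor_of_comp f.left Y.hom (by rw [Over.w f]; exact hX.out) hY.out

instance {S : Scheme.{u}} {X Y Z : Over S} [hX : IsVar X] [IsVar Y] [IsVar Z]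
    (f : X ⟶ Z) (g : Y ⟶ Z) : IsVar (pullback f g) := ⟨by
  rw [← Over.w (pullback.fst f g)]
  refine varMor.comp_mem _ _ ?_ hX.out
  exact varMor.of_isPullback ((IsPullback.of_hasPullback f g).map (Over.forget S)).flip
    (varMor_left g)⟩

/-- The class `[X]` in the Grothendieck ring of varieties over `S`. -/
def virtualClass {S : Scheme.{u}} (X : Over S) [hX : IsVar X] : K0 S := K0.cls X hX.out

/-- The homomorphism `g_! ∘ f^*` attached to a span `A ⟵ D ⟶ B` of varieties. -/
def pushPull {S : Scheme.{u}} {A D B : Over S} [IsVar D] [IsVar B] (f : D ⟶ A) (g : D ⟶ B) :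
    K0 A.left →+ K0 B.left :=
  (push g.left (varMor_left g)).comp (pull f.left).toAddMonoidHom

/-! ### Parabolic data and parabolic representation varieties -/

/-- A (locally closed, reduced) subvariety of `G` which is closed under conjugation: for all points
`g` of `G` and `x` of the subvariety, `g x g⁻¹` lies in the subvariety. Here `S` is the spectrum of
an algebraically closed field `k`, and points are `k`-points. -/
structure ConjSubvariety {S : Scheme.{u}} (G : Over S) [GrpObj G] where
  obj : Over S
  incl : obj ⟶ G
  isVar : IsVar obj
  isReduced : IsReduced obj.left
  isImmersion : IsImmersion incl.left
  conj : ∀ (g : 𝟙_ (Over S) ⟶ G) (x : 𝟙_ (Over S) ⟶ obj),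
    ∃ y : 𝟙_ (Over S) ⟶ obj, y ≫ incl = g * (x ≫ incl) * g⁻¹

attribute [instance] ConjSubvariety.isVar ConjSubvariety.isReduced ConjSubvariety.isImmersion

/-- Evaluation of a word in the generators `i : I`, as a morphism `G^I ⟶ G`. -/
def evalWord {S : Scheme.{u}} (G : Over S) [GrpObj G] {I : Type} [Finite I] :
    FreeGroup I →* ((∏ᶜ fun _ : I => G) ⟶ G) :=
  FreeGroup.lift fun i => Pi.π (fun _ : I => G) i

/-- The evaluation of the relators and of the parabolic elements, `G^I ⟶ G^κ × G^σ`. -/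
def wordMap {S : Scheme.{u}} (G : Over S) [GrpObj G] {I κ σ : Type} [Finite I] [Finite κ]
    [Finite σ] (rel : κ → FreeGroup I) (w : σ → FreeGroup I) :
    (∏ᶜ fun _ : I => G) ⟶ (∏ᶜ fun _ : κ => G) ⊗ (∏ᶜ fun _ : σ => G) :=
  lift (Pi.lift fun c => evalWord G (rel c)) (Pi.lift fun j => evalWord G (w j))

/-- The inclusion `1 × ∏ j, Q j ⟶ G^κ × G^σ`. -/
def dataMap {S : Scheme.{u}} (G : Over S) [GrpObj G] (κ : Type) {σ : Type} [Finite κ]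
    [Finite σ] (Q : σ → ConjSubvariety G) :
    (∏ᶜ fun j => (Q j).obj) ⟶ (∏ᶜ fun _ : κ => G) ⊗ (∏ᶜ fun _ : σ => G) :=
  lift (Pi.lift fun _ => 1) (Limits.Pi.map fun j => (Q j).incl)

/-- The parabolic representation variety of the group `⟨I ∣ rel⟩` with parabolic structure
`{(w j, Q j)}`: the subvariety of `G^I` cut out by the equations `rel c = 1` and the
conditions `w j ∈ Q j`, that is, the fibre product of `(rel, w) : G^I ⟶ G^κ × G^σ` and
the inclusion `1 × ∏ j, Q j ⟶ G^κ × G^σ`. -/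
abbrev RepVariety {S : Scheme.{u}} (G : Over S) [GrpObj G] {I κ σ : Type} [Finite I] [Finite κ]
    [Finite σ] (rel : κ → FreeGroup I) (w : σ → FreeGroup I) (Q : σ → ConjSubvariety G) :
    Over S :=
  pullback (wordMap G rel w) (dataMap G κ Q)

/-- The embedding of the representation variety in `G^I`: the images of the generators. -/
abbrev RepVariety.emb {S : Scheme.{u}} (G : Over S) [GrpObj G] {I κ σ : Type} [Finite I] [Finite κ]
    [Finite σ] (rel : κ → FreeGroup I) (w : σ → FreeGroup I) (Q : σ → ConjSubvariety G) :
    RepVariety G rel w Q ⟶ ∏ᶜ fun _ : I => G :=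
  pullback.fst _ _

lemma comp_evalWord {S : Scheme.{u}} (G : Over S) [GrpObj G] {I : Type} [Finite I] {T : Over S}
    (f : T ⟶ ∏ᶜ fun _ : I => G) (v : FreeGroup I) :
    f ≫ evalWord G v = FreeGroup.lift (fun i => f ≫ Pi.π (fun _ : I => G) i) v := by
  let φ : FreeGroup I →* (T ⟶ G) :=
    MonoidHom.mk' (fun v => f ≫ evalWord G v) fun a b => by
      rw [map_mul, MonObj.comp_mul]
  have : φ = FreeGroup.lift (fun i => f ≫ Pi.π (fun _ : I => G) i) := by
    ext i; simp [φ, evalWord]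
  exact DFunLike.congr_fun this v

lemma comp_wordMap_eq_iff {S : Scheme.{u}} (G : Over S) [GrpObj G] {I κ σ : Type}
    [Finite I] [Finite κ] [Finite σ] (rel : κ → FreeGroup I) (w : σ → FreeGroup I)
    (Q : σ → ConjSubvariety G) {T : Over S} (p : T ⟶ ∏ᶜ fun _ : I => G)
    (q : T ⟶ ∏ᶜ fun j => (Q j).obj) :
    p ≫ wordMap G rel w = q ≫ dataMap G κ Q ↔
      (∀ c, FreeGroup.lift (fun i => p ≫ Pi.π (fun _ : I => G) i) (rel c) = 1) ∧
        ∀ j, FreeGroup.lift (fun i => p ≫ Pi.π (fun _ : I => G) i) (w j) =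
          (q ≫ Pi.π _ j) ≫ (Q j).incl := by
  simp only [← comp_evalWord]
  constructor
  · intro h
    have h1 := h =≫ fst _ _
    have h2 := h =≫ snd _ _
    simp only [wordMap, dataMap, Category.assoc, lift_fst, lift_snd] at h1 h2
    refine ⟨fun c => ?_, fun j => ?_⟩
    · simpa [MonObj.comp_one] using h1 =≫ Pi.π _ c
    · simpa using h2 =≫ Pi.π _ j
  · rintro ⟨h1, h2⟩
    apply CartesianMonoidalCategory.hom_ext
    · simp only [wordMap, dataMap, Category.assoc, lift_fst]
      refine Limits.Pi.hom_ext _ _ fun c => ?_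
      simpa [MonObj.comp_one] using h1 c
    · simp only [wordMap, dataMap, Category.assoc, lift_snd]
      refine Limits.Pi.hom_ext _ _ fun j => ?_
      simpa using h2 j

/-- The points of the representation variety with values in `T` are the representations `ρ` of the
presented group in the group of `T`-points of `G` such that `ρ (w j)` lies in `Q j` for all `j`. -/
theorem RepVariety.existsUnique_iff {S : Scheme.{u}} (G : Over S) [GrpObj G] {I κ σ : Type}
    [Finite I] [Finite κ] [Finite σ] (rel : κ → FreeGroup I) (w : σ → FreeGroup I)
    (Q : σ → ConjSubvariety G) (T : Over S) (A : I → (T ⟶ G)) :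
    (∃! f : T ⟶ RepVariety G rel w Q,
        ∀ i, f ≫ RepVariety.emb G rel w Q ≫ Pi.π (fun _ : I => G) i = A i) ↔
      ∃ ρ : PresentedGroup (Set.range rel) →* (T ⟶ G),
        (∀ i, ρ (PresentedGroup.of i) = A i) ∧
          ∀ j, ∃ y : T ⟶ (Q j).obj, y ≫ (Q j).incl = ρ (PresentedGroup.mk _ (w j)) := by
  have mono : ∀ j, Mono (Q j).incl := fun j =>
    have : Mono ((Over.forget S).map (Q j).incl) := inferInstanceAs (Mono (Q j).incl.left)
    (Over.forget S).mono_of_mono_map this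
  constructor
  · rintro ⟨f, hf, -⟩
    have hp : (fun i => (f ≫ RepVariety.emb G rel w Q) ≫ Pi.π (fun _ : I => G) i) = A :=
      funext fun i => by rw [Category.assoc, hf i]
    obtain ⟨h1, h2⟩ := (comp_wordMap_eq_iff G rel w Q (f ≫ RepVariety.emb G rel w Q)
      (f ≫ pullback.snd _ _)).1 (by
        rw [Category.assoc, Category.assoc]; exact f ≫= pullback.condition)
    rw [hp] at h1 h2
    exact ⟨PresentedGroup.toGroup (f := A) (by rintro _ ⟨c, rfl⟩; exact h1 c),
      fun i => PresentedGroup.toGroup.of _, fun j => ⟨_, (h2 j).symm⟩⟩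
  · rintro ⟨ρ, hρ, hy⟩
    choose y hy using hy
    have hlift : FreeGroup.lift A = ρ.comp (PresentedGroup.mk (Set.range rel)) := by
      refine FreeGroup.ext_hom _ _ fun i => ?_
      rw [FreeGroup.lift_apply_of]; exact (hρ i).symm
    have hA : (fun i => Pi.lift A ≫ Pi.π (fun _ : I => G) i) = A := by ext1 i; simp
    have hc : Pi.lift A ≫ wordMap G rel w = Pi.lift y ≫ dataMap G κ Q := by
      rw [comp_wordMap_eq_iff, hA, hlift]
      refine ⟨fun c => ?_, fun j => ?_⟩
      · have : PresentedGroup.mk (Set.range rel) (rel c) = 1 :=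
          PresentedGroup.one_of_mem ⟨c, rfl⟩
        simp [this]
      · simp [hy]
    refine ⟨pullback.lift _ _ hc, fun i => ?_, fun f hf => ?_⟩
    · rw [pullback.lift_fst_assoc]; simp
    · have h1 : f ≫ pullback.fst _ _ = Pi.lift A := Limits.Pi.hom_ext _ _ fun i => by
        rw [Category.assoc]; simpa using hf i
      refine pullback.hom_ext (h1.trans (pullback.lift_fst _ _ hc).symm) ?_
      refine Limits.Pi.hom_ext _ _ fun j => ?_
      have h2 : f ≫ pullback.fst (wordMap G rel w) (dataMap G κ Q) ≫ wordMap G rel w =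
        f ≫ pullback.snd _ _ ≫ dataMap G κ Q := f ≫= pullback.condition
      rw [← Category.assoc, ← Category.assoc, comp_wordMap_eq_iff] at h2
      have h3 := h2.2 j
      rw [h1, hA, hlift] at h3
      rw [← cancel_mono (Q j).incl, ← h3, pullback.lift_snd]
      simp [hy]

/-! ### Surfaces -/

/-- The generators `a i, b i` (`i < g`) and `c j` (`j < s`) of the fundamental group of the closed
oriented surface of genus `g` with `s` punctures. -/
inductive SurfaceGen (g s : ℕ) : Type
  | a (i : Fin g) : SurfaceGen g s
  | b (i : Fin g) : SurfaceGen g s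
  | c (j : Fin s) : SurfaceGen g s

instance (g s : ℕ) : Finite (SurfaceGen g s) :=
  Finite.of_surjective (α := (Fin g ⊕ Fin g) ⊕ Fin s)
    (Sum.elim (Sum.elim SurfaceGen.a SurfaceGen.b) SurfaceGen.c) (by
      rintro (i | i | j)
      exacts [⟨.inl (.inl i), rfl⟩, ⟨.inl (.inr i), rfl⟩, ⟨.inr j, rfl⟩])

/-- The relator `a₁ b₁ a₁⁻¹ b₁⁻¹ ⋯ a_g b_g a_g⁻¹ b_g⁻¹ c₁ ⋯ c_s`. -/
def surfaceRelator (g s : ℕ) : FreeGroup (SurfaceGen g s) :=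
  (List.ofFn fun i : Fin g =>
      FreeGroup.of (SurfaceGen.a (s := s) i) * FreeGroup.of (SurfaceGen.b i) *
        (FreeGroup.of (SurfaceGen.a i))⁻¹ * (FreeGroup.of (SurfaceGen.b i))⁻¹).prod *
    (List.ofFn fun j : Fin s => FreeGroup.of (SurfaceGen.c (g := g) j)).prod

/-- The meridian of the `j`-th puncture: the simple loop `c j`, or its inverse if the orientation of
the chosen disc around the puncture is opposite to that of the surface (`ε j = -1`). -/
def meridian {g s : ℕ} (ε : Fin s → ℤˣ) (j : Fin s) : FreeGroup (SurfaceGen g s) :=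
  FreeGroup.of (SurfaceGen.c j) ^ (ε j : ℤ)

/-- The parabolic representation variety of the closed oriented surface of genus `g` with `s` marked
points with data `Q j` and local orientations `ε j`. -/
def SurfaceRepVariety {S : Scheme.{u}} (G : Over S) [GrpObj G] (g s : ℕ)
    (Q : Fin s → ConjSubvariety G) (ε : Fin s → ℤˣ) : Over S :=
  RepVariety G (fun _ : Unit => surfaceRelator g s) (meridian ε) Q

instance {S : Scheme.{u}} (G : Over S) [GrpObj G] [IsVar G] (g s : ℕ)
    (Q : Fin s → ConjSubvariety G) (ε : Fin s → ℤˣ) : IsVar (SurfaceRepVariety G g s Q ε) := by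
  unfold SurfaceRepVariety; infer_instance

/-! ### The homomorphisms attached to discs and tubes -/

section Bordisms

variable {S : Scheme.{u}} (G : Over S) [GrpObj G] [IsVar G]

/-- The disc `D`: the push-forward `i_!` along the inclusion `i` of the unit. -/
def zDisc : K0 S →+ K0 G.left :=
  push (S := S) η[G].left (varMor_left η[G])

/-- The opposite disc `D†`: the pullback `i^*` along the inclusion `i` of the unit. -/
def zDiscDagger : K0 G.left →+ K0 S :=
  (pull (S := S) η[G].left).toAddMonoidHom

/-- The holed torus `L`: the span `G ⟵ G⁴ ⟶ G`, with legs `(x, a, b, h) ↦ x` and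
`(x, a, b, h) ↦ h x (a b a⁻¹ b⁻¹) h⁻¹`. -/
def zHoledTorus : AddMonoid.End (K0 G.left) :=
  let x : G ⊗ G ⊗ G ⊗ G ⟶ G := fst _ _
  let a : G ⊗ G ⊗ G ⊗ G ⟶ G := snd _ _ ≫ fst _ _
  let b : G ⊗ G ⊗ G ⊗ G ⟶ G := snd _ _ ≫ snd _ _ ≫ fst _ _
  let h : G ⊗ G ⊗ G ⊗ G ⟶ G := snd _ _ ≫ snd _ _ ≫ snd _ _
  pushPull x (h * x * (a * b * a⁻¹ * b⁻¹) * h⁻¹)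

/-- The tube with a marked point with datum `Q`, whose local orientation is given by the sign `e`:
the span `G ⟵ G² × Q ⟶ G`, with legs `(x, h, ξ) ↦ x` and `(x, h, ξ) ↦ h x ξᵉ h⁻¹`. -/
def zTube (Q : ConjSubvariety G) (e : ℤˣ) : AddMonoid.End (K0 G.left) :=
  let x : G ⊗ G ⊗ Q.obj ⟶ G := fst _ _
  let h : G ⊗ G ⊗ Q.obj ⟶ G := snd _ _ ≫ fst _ _
  let ξ : G ⊗ G ⊗ Q.obj ⟶ G := snd _ _ ≫ snd _ _ ≫ Q.incl
  pushPull x (h * x * ξ ^ (e : ℤ) * h⁻¹)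

/-- The composite `Z(D†) ∘ Z(L_{λ_s}) ∘ ⋯ ∘ Z(L_{λ_1}) ∘ Z(L)^g ∘ Z(D)`. -/
def zSurface (g s : ℕ) (Q : Fin s → ConjSubvariety G) (ε : Fin s → ℤˣ) : K0 S →+ K0 S :=
  (zDiscDagger G).comp
    (AddMonoidHom.comp ((List.ofFn fun j : Fin s => zTube G (Q j) (ε j)).reverse.prod)
      (AddMonoidHom.comp (zHoledTorus G ^ g) (zDisc G)))

end Bordisms

end RepTQFT
end

/-!
The operators attached to tubes and holed tori factor as `conjugation * convolution c`: right
multiplication by a family `c : D ⟶ G`, followed by conjugation by all elements of `G`. If `c` is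
stable under conjugation, the two factors commute: substituting `h (c d) h⁻¹` for `c d` does not
change the class of the family. (Stability is only known on reduced points, which is enough because
classes in the Grothendieck ring do not see nilpotents.) All `g + s` conjugations can thus be
collected in front of `D†`. The equation `h x h⁻¹ = 1` does not depend on `h`, so `D†` turns each of
them into a factor `[G]`. The convolutions compose to the convolution by the product of all
commutators and parabolic elements; applied to the class of the unit and restricted to the unit, it
gives the class of the fibre of that product over `1`, which is the representation variety.
-/

noncomputable section

namespace RepTQFT

/-! ### Reduced subschemes and factorisation through immersions -/

lemma isReduced_subscheme_nilradical (X : Scheme.{u}) : IsReduced X.nilradical.subscheme := by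
  have (U : X.nilradical.subschemeCover.openCover.I₀) :
      IsReduced (X.nilradical.subschemeCover.openCover.X U) := by
    have : _root_.IsReduced (Γ(X, U.1) ⧸ X.nilradical.ideal U) := by
      rw [← Ideal.isRadical_iff_quotient_reduced]
      exact Ideal.radical_isRadical _
    exact inferInstanceAs (IsReduced (Spec (.of (Γ(X, U.1) ⧸ X.nilradical.ideal U))))
  exact IsReduced.of_openCover (𝒰 := X.nilradical.subschemeCover.openCover)

lemma exists_isReduced_isClosedImmersion_surjective {S : Scheme.{u}} (Y : Over S) :
    ∃ (Z : Over S) (i : Z ⟶ Y),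
      IsReduced Z.left ∧ IsClosedImmersion i.left ∧ Surjective i.left := by
  let i := Y.left.nilradical.subschemeι
  have hi : Surjective i := ⟨by
    rw [← Set.range_eq_univ, Scheme.IdealSheafData.range_subschemeι]
    rfl⟩
  have hi' : IsClosedImmersion i := inferInstance
  exact ⟨Over.mk (i ≫ Y.hom), Over.homMk i, isReduced_subscheme_nilradical Y.left, hi', hi⟩

lemma exists_lift_of_range_subset {S : Scheme.{u}} {T X Y : Over S} [IsReduced T.left]
    (f : T ⟶ Y) (i : X ⟶ Y) [IsImmersion i.left] (h : Set.range f.left ⊆ Set.range i.left) :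
    ∃ g : T ⟶ X, g ≫ i = f := by
  let p := pullback.fst f.left i.left
  have hp : Set.range p = Set.univ := by
    rw [Scheme.Pullback.range_fst, Set.eq_univ_iff_forall]
    exact fun x => h ⟨x, rfl⟩
  have : Surjective p := ⟨Set.range_eq_univ.1 hp⟩
  have : IsClosedImmersion p := .of_isPreimmersion _ (hp ▸ isClosed_univ)
  have : IsIso p := isIso_of_isClosedImmersion_of_surjective p
  have hg : (inv p ≫ pullback.snd f.left i.left) ≫ i.left = f.left := by
    rw [Category.assoc, ← pullback.condition, IsIso.inv_hom_id_assoc]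
  exact ⟨Over.homMk _ (by rw [← Over.w i, ← Category.assoc, hg, Over.w]), Over.OverMorphism.ext hg⟩

lemma eq_univ_of_isLocallyClosed_of_closedPoints_subset {X : Type*} [TopologicalSpace X]
    [JacobsonSpace X] {s : Set X} (hs : IsLocallyClosed s) (h : closedPoints X ⊆ s) :
    s = Set.univ := by
  have hdense : Dense s := Dense.mono h (dense_iff_closure_eq.2 closure_closedPoints)
  have hopen : IsOpen s := by
    simpa [coborder_eq_union_closure_compl, hdense.closure_eq] using hs.isOpen_coborder
  by_contra hne
  obtain ⟨x, hxs, hx⟩ := nonempty_inter_closedPoints (Set.nonempty_compl.2 hne)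
    hopen.isClosed_compl.isLocallyClosed
  exact hxs (h hx)

lemma exists_lift_of_forall_rationalPoint {k : Type u} [Field k] [IsAlgClosed k]
    {T X Y : Over (Spec (.of k))} [IsReduced T.left] [LocallyOfFiniteType T.hom] (f : T ⟶ Y)
    (i : X ⟶ Y) [IsImmersion i.left]
    (h : ∀ t : 𝟙_ (Over (Spec (.of k))) ⟶ T, ∃ x : 𝟙_ (Over (Spec (.of k))) ⟶ X, x ≫ i = t ≫ f) :
    ∃ g : T ⟶ X, g ≫ i = f := by
  have := LocallyOfFiniteType.jacobsonSpace T.hom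
  have hclosed : closedPoints T.left ⊆ f.left ⁻¹' Set.range i.left := fun t ht => by
    obtain ⟨x, hx⟩ := h (Over.homMk (pointOfClosedPoint T.hom t ht)
      (pointOfClosedPoint_comp T.hom t ht))
    exact ⟨x.left (IsLocalRing.closedPoint k), congr(($hx).left (IsLocalRing.closedPoint k)).trans
      (congrArg f.left (pointOfClosedPoint_apply T.hom t ht _))⟩
  have huniv := eq_univ_of_isLocallyClosed_of_closedPoints_subset
    (i.left.isLocallyClosed_range.preimage f.left.continuous) hclosed
  refine exists_lift_of_range_subset f i ?_
  rintro _ ⟨t, rfl⟩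
  exact Set.eq_univ_iff_forall.1 huniv t

/-! ### Classes of morphisms of varieties -/

section Classes

variable {S : Scheme.{u}}

lemma isVar_of_isClosedImmersion {Z Y : Over S} [hY : IsVar Y] (i : Z ⟶ Y)
    [IsClosedImmersion i.left] : IsVar Z := by
  refine ⟨?_⟩
  rw [← Over.w i]
  exact varMor.comp_mem _ _ ⟨inferInstance, inferInstance, inferInstance⟩ hY.out

lemma mono_of_mono_left {Z Y : Over S} (i : Z ⟶ Y) [h : Mono i.left] : Mono i :=
  have : Mono ((Over.forget S).map i) := h
  (Over.forget S).mono_of_mono_map this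

/-- The class `[Y ⟶ B]` in `K0(Var/B)` of a morphism between varieties over `S`. -/
def relCls {Y B : Over S} [IsVar Y] [IsVar B] (f : Y ⟶ B) : K0 B.left :=
  K0.cls (Over.mk f.left) (varMor_left f)

lemma virtualClass_tensor (X Y : Over S) [hX : IsVar X] [hY : IsVar Y] :
    virtualClass (X ⊗ Y) = virtualClass X * virtualClass Y :=
  (congrArg (K0.mk S) (gen_mul ⟨X, hX.out⟩ ⟨Y, hY.out⟩)).symm.trans (map_mul _ _ _)

lemma relCls_eq_of_iso {Y Y' B : Over S} [IsVar Y] [IsVar Y'] [IsVar B] {f : Y ⟶ B}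
    {f' : Y' ⟶ B} (e : Y ≅ Y') (h : e.hom ≫ f' = f) : relCls f = relCls f' :=
  congrArg (K0.mk B.left) (gen_eq_of_iso (Over.isoMk ((Over.forget S).mapIso e)
    congr(($h).left)))

lemma relCls_toUnit (P : Over S) [IsVar P] :
    (relCls (toUnit P) : K0 (𝟙_ (Over S)).left) = (virtualClass P : K0 S) :=
  congrArg (K0.mk S) (gen_eq_of_iso (Over.isoMk (Iso.refl _) (by simp)))

lemma addMonoidHom_ext_relCls {B : Over S} [hB : IsVar B] {A : Type*} [AddCommGroup A]
    {φ ψ : K0 B.left →+ A}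
    (h : ∀ (Y : Over S) [IsVar Y] (f : Y ⟶ B), φ (relCls f) = ψ (relCls f)) : φ = ψ := by
  refine QuotientAddGroup.addMonoidHom_ext _ (FreeAbelianGroup.lift_ext _ _ fun y => ?_)
  obtain ⟨Y, rfl⟩ := Quotient.exists_rep y
  have : IsVar (Over.mk (Y.1.hom ≫ B.hom)) := ⟨varMor.comp_mem _ _ Y.2 hB.out⟩
  exact h (Over.mk (Y.1.hom ≫ B.hom)) (Over.homMk Y.1.hom)

lemma varMor_emptyTo (T : Scheme.{u}) : varMor (Scheme.emptyTo T) :=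
  ⟨inferInstance, inferInstance,
    ⟨fun s _ _ => (Set.toFinite (Scheme.emptyTo T ⁻¹' s)).isCompact⟩⟩

lemma K0.mk_gen_of_isEmpty {T : Scheme.{u}} (Y : VarOver T) [IsEmpty Y.1.left] :
    K0.mk T (gen Y) = 0 := by
  have := mk_eq_zero_of_decomposition (Y := Y) (Z := Y) (U := Y)
    ⟨𝟙 _, 𝟙 _, inferInstanceAs (IsClosedImmersion (𝟙 Y.1.left)),
      inferInstanceAs (IsOpenImmersion (𝟙 Y.1.left)), Subsingleton.elim _ _⟩
  simpa using this

lemma K0.mk_gen_eq_of_surjective {T : Scheme.{u}} {Y Z : VarOver T} (i : Z.1 ⟶ Y.1)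
    [IsClosedImmersion i.left] [Surjective i.left] : K0.mk T (gen Z) = K0.mk T (gen Y) := by
  let U : VarOver T := ⟨Over.mk (Scheme.emptyTo T), varMor_emptyTo T⟩
  have : IsEmpty U.1.left := inferInstanceAs (IsEmpty (∅ : Scheme.{u}))
  have hcompl : Set.range i.left = (Set.range (Scheme.emptyTo Y.1.left))ᶜ := by
    rw [Set.range_eq_empty (Scheme.emptyTo Y.1.left), Set.compl_empty]
    exact Set.range_eq_univ.2 i.left.surjective
  have := mk_eq_zero_of_decomposition (Y := Y) (Z := Z) (U := U)
    ⟨i, Over.homMk (Scheme.emptyTo Y.1.left) (emptyIsInitial.hom_ext _ _), ‹_›,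
      inferInstanceAs (IsOpenImmersion (Scheme.emptyTo Y.1.left)), hcompl⟩
  rw [map_sub, map_sub, K0.mk_gen_of_isEmpty U, sub_zero, sub_eq_zero] at this
  exact this.symm

lemma relCls_comp_of_surjective {Z Y B : Over S} [IsVar Z] [IsVar Y] [IsVar B] (i : Z ⟶ Y)
    [hi : IsClosedImmersion i.left] [hi' : Surjective i.left] (f : Y ⟶ B) :
    relCls (i ≫ f) = relCls f :=
  let j : Over.mk (i ≫ f).left ⟶ Over.mk f.left := Over.homMk i.left
  have : IsClosedImmersion j.left := hi
  have : Surjective j.left := hi'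
  K0.mk_gen_eq_of_surjective (Y := ⟨Over.mk f.left, varMor_left f⟩)
    (Z := ⟨Over.mk (i ≫ f).left, varMor_left (i ≫ f)⟩) j

lemma relCls_eq_of_forall_reduced {Y Y' W : Over S} [IsVar Y] [IsVar Y'] [IsVar W]
    (j : Y ⟶ W) (j' : Y' ⟶ W) [Mono j] [Mono j']
    (h : ∀ (T : Over S) [IsVar T] [IsReduced T.left] (t : T ⟶ W),
      (∃ a : T ⟶ Y, a ≫ j = t) ↔ ∃ a : T ⟶ Y', a ≫ j' = t) :
    relCls j = relCls j' := by
  obtain ⟨Z, i, hZ, hi, hi_surj⟩ := exists_isReduced_isClosedImmersion_surjective Y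
  obtain ⟨Z', i', hZ', hi', hi'_surj⟩ := exists_isReduced_isClosedImmersion_surjective Y'
  have := isVar_of_isClosedImmersion i
  have := isVar_of_isClosedImmersion i'
  have := mono_of_mono_left i
  have := mono_of_mono_left i'
  obtain ⟨a, ha⟩ := (h Z (i ≫ j)).1 ⟨i, rfl⟩
  obtain ⟨b, hb⟩ := (h Z' (i' ≫ j')).2 ⟨i', rfl⟩
  obtain ⟨a, rfl⟩ := exists_lift_of_range_subset a i' fun x _ => i'.left.surjective x
  obtain ⟨b, rfl⟩ := exists_lift_of_range_subset b i fun x _ => i.left.surjective x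
  simp only [Category.assoc] at ha hb
  rw [← relCls_comp_of_surjective i j, ← relCls_comp_of_surjective i' j']
  refine relCls_eq_of_iso ⟨a, b, ?_, ?_⟩ ha
  · rw [← cancel_mono (i ≫ j), Category.assoc, hb, ha, Category.id_comp]
  · rw [← cancel_mono (i' ≫ j'), Category.assoc, ha, hb, Category.id_comp]

lemma push_relCls {Y A B : Over S} [IsVar Y] [IsVar A] [IsVar B] (f : Y ⟶ A) (g : A ⟶ B) :
    push g.left (varMor_left g) (relCls f) = relCls (f ≫ g) :=
  push_cls _ _ _ _

lemma pull_relCls {Y A D P : Over S} [IsVar Y] [IsVar A] [IsVar D] [IsVar P] {y : Y ⟶ A}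
    {f : D ⟶ A} {p : P ⟶ Y} {q : P ⟶ D} (h : IsPullback p q y f) :
    pull f.left (relCls y) = relCls q := by
  have hleft := h.map (Over.forget S)
  refine (pull_cls f.left (Over.mk y.left) (varMor_left y)).trans ?_
  exact congrArg (K0.mk D.left) (gen_eq_of_iso (Over.isoMk hleft.isoPullback.symm
    hleft.isoPullback_inv_snd))

lemma pushPull_relCls {Y A B D P : Over S} [IsVar Y] [IsVar A] [IsVar B] [IsVar D] [IsVar P]
    {y : Y ⟶ A} {f : D ⟶ A} {p : P ⟶ Y} {q : P ⟶ D} (h : IsPullback p q y f) (g : D ⟶ B) :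
    pushPull f g (relCls y) = relCls (q ≫ g) := by
  rw [← push_relCls, ← pull_relCls h]
  rfl

lemma isPullback_whiskerRight {C : Type*} [Category* C] [CartesianMonoidalCategory C]
    {Y A : C} (y : Y ⟶ A) (D : C) : IsPullback (fst Y D) (y ▷ D) y (fst A D) :=
  IsPullback.of_isLimit' ⟨by simp⟩ <| PullbackCone.IsLimit.mk _
    (fun s => lift s.fst (s.snd ≫ snd A D)) (fun s => by simp)
    (fun s => by ext <;> simp [s.condition])
    (fun s m h1 h2 => by ext <;> simp [h1, ← h2])

lemma pushPull_fst_relCls {Y A B D : Over S} [IsVar Y] [IsVar A] [IsVar B] [IsVar D]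
    (y : Y ⟶ A) (m : A ⊗ D ⟶ B) : pushPull (fst A D) m (relCls y) = relCls (y ▷ D ≫ m) :=
  pushPull_relCls (isPullback_whiskerRight y D) m

lemma relCls_comp_congr {Y Y' A B : Over S} [IsVar Y] [IsVar Y'] [IsVar A] [IsVar B]
    {f : Y ⟶ A} {f' : Y' ⟶ A} (h : relCls f = relCls f') (m : A ⟶ B) :
    relCls (f ≫ m) = relCls (f' ≫ m) := by
  rw [← push_relCls, h, push_relCls]

lemma relCls_whiskerRight_congr {Y Y' A : Over S} [IsVar Y] [IsVar Y'] [IsVar A]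
    {f : Y ⟶ A} {f' : Y' ⟶ A} (h : relCls f = relCls f') (W : Over S) [IsVar W] :
    relCls (f ▷ W) = relCls (f' ▷ W) := by
  rw [← pull_relCls (isPullback_whiskerRight f W), h,
    pull_relCls (isPullback_whiskerRight f' W)]

end Classes

/-! ### Conjugation and convolution operators -/

section Operators

variable {S : Scheme.{u}} {G : Over S} [GrpObj G] [IsVar G]

lemma end_ext_relCls {B : Over S} [IsVar B] {φ ψ : AddMonoid.End (K0 B.left)}
    (h : ∀ (Y : Over S) [IsVar Y] (f : Y ⟶ B), φ (relCls f) = ψ (relCls f)) : φ = ψ :=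
  addMonoidHom_ext_relCls h

variable (G) in
/-- The operator which conjugates by all elements of `G`: the span `G ⟵ G² ⟶ G` with legs
`(x, h) ↦ x` and `(x, h) ↦ h x h⁻¹`. -/
def conjugation : AddMonoid.End (K0 G.left) :=
  pushPull (fst G G) (snd G G * fst G G * (snd G G)⁻¹)

/-- The operator which multiplies from the right by the elements of a family `c : D ⟶ G`: the span
`G ⟵ G × D ⟶ G` with legs `(x, d) ↦ x` and `(x, d) ↦ x (c d)`. -/
def convolution {D : Over S} [IsVar D] (c : D ⟶ G) : AddMonoid.End (K0 G.left) :=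
  pushPull (fst G D) (fst G D * snd G D ≫ c)

lemma conjugation_relCls {Y : Over S} [IsVar Y] (y : Y ⟶ G) :
    conjugation G (relCls y) = relCls (snd Y G * fst Y G ≫ y * (snd Y G)⁻¹) := by
  refine (pushPull_fst_relCls y _).trans (congrArg relCls ?_)
  simp [MonObj.comp_mul, GrpObj.comp_inv]

lemma convolution_relCls {Y D : Over S} [IsVar Y] [IsVar D] (c : D ⟶ G) (y : Y ⟶ G) :
    convolution c (relCls y) = relCls (fst Y D ≫ y * snd Y D ≫ c) := by
  refine (pushPull_fst_relCls y _).trans (congrArg relCls ?_)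
  simp [MonObj.comp_mul]

lemma convolution_congr {D D' : Over S} [IsVar D] [IsVar D'] {c : D ⟶ G} {c' : D' ⟶ G}
    (h : relCls c = relCls c') : convolution c = convolution c' := by
  have hswap {E : Over S} [IsVar E] (d : E ⟶ G) (Y : Over S) [IsVar Y] (y : Y ⟶ G) :
      convolution d (relCls y) = relCls (d ▷ Y ≫ (snd G Y ≫ y * fst G Y)) := by
    rw [convolution_relCls]
    exact relCls_eq_of_iso (β_ Y E) (by simp [MonObj.comp_mul])
  refine end_ext_relCls fun Y _ y => ?_
  rw [hswap, hswap, relCls_comp_congr (relCls_whiskerRight_congr h Y)]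

lemma convolution_one : convolution η[G] = 1 := by
  refine end_ext_relCls fun Y _ y => ?_
  rw [convolution_relCls]
  refine relCls_eq_of_iso (ρ_ Y) ?_
  rw [← toUnit_unique (toUnit _) (snd Y (𝟙_ (Over S))), ← Hom.one_def, _root_.mul_one,
    rightUnitor_hom]

lemma convolution_mul_convolution {D D' : Over S} [IsVar D] [IsVar D'] (c : D ⟶ G) (c' : D' ⟶ G) :
    convolution c' * convolution c = convolution (fst D D' ≫ c * snd D D' ≫ c') := by
  refine end_ext_relCls fun Y _ y => ?_
  rw [AddMonoid.End.coe_mul, Function.comp_apply, convolution_relCls, convolution_relCls,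
    convolution_relCls]
  exact relCls_eq_of_iso (α_ Y D D') (by simp [MonObj.comp_mul, _root_.mul_assoc])

lemma zHoledTorus_eq :
    zHoledTorus G = conjugation G * convolution (GrpObj.commutator G) := by
  refine end_ext_relCls fun Y _ y => ?_
  rw [AddMonoid.End.coe_mul, Function.comp_apply, convolution_relCls, conjugation_relCls]
  refine (pushPull_fst_relCls y _).trans (relCls_eq_of_iso
    ((Iso.refl Y ⊗ᵢ (α_ G G G).symm) ≪≫ (α_ Y (G ⊗ G) G).symm) ?_)
  simp [GrpObj.commutator, MonObj.comp_mul, GrpObj.comp_inv, _root_.mul_assoc]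

lemma zTube_eq (Q : ConjSubvariety G) (e : ℤˣ) :
    zTube G Q e = conjugation G * convolution (Q.incl ^ (e : ℤ)) := by
  refine end_ext_relCls fun Y _ y => ?_
  rw [AddMonoid.End.coe_mul, Function.comp_apply, convolution_relCls, conjugation_relCls]
  refine (pushPull_fst_relCls y _).trans (relCls_eq_of_iso
    ((Iso.refl Y ⊗ᵢ β_ G Q.obj) ≪≫ (α_ Y Q.obj G).symm) ?_)
  simp [MonObj.comp_mul, GrpObj.comp_inv, GrpObj.comp_zpow, _root_.mul_assoc]

end Operators

/-! ### Conjugation-invariant families -/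

section ConjIso

variable {C : Type*} [Category* C] [CartesianMonoidalCategory C] (G : C) [GrpObj G]

/-- The automorphism `(x, h) ↦ (h x h⁻¹, h)` of `G²`. -/
def conjIso : G ⊗ G ≅ G ⊗ G where
  hom := lift (snd G G * fst G G * (snd G G)⁻¹) (snd G G)
  inv := lift ((snd G G)⁻¹ * fst G G * snd G G) (snd G G)
  hom_inv_id := by ext <;> simp [MonObj.comp_mul, GrpObj.comp_inv, _root_.mul_assoc]
  inv_hom_id := by ext <;> simp [MonObj.comp_mul, GrpObj.comp_inv, _root_.mul_assoc]

lemma conjIso_hom_fst : (conjIso G).hom ≫ fst G G = snd G G * fst G G * (snd G G)⁻¹ :=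
  lift_fst _ _

lemma conjIso_hom_snd : (conjIso G).hom ≫ snd G G = snd G G :=
  lift_snd _ _

end ConjIso

section ConjInvariant

variable {S : Scheme.{u}} {G : Over S} [GrpObj G] [IsVar G]

/-- A family `c : D ⟶ G` is invariant under conjugation, as far as the Grothendieck ring can see:
the families `(d, h) ↦ h (c d) h⁻¹` and `(d, h) ↦ c d`, both over the parameter `h`, have the same
class in `K0(Var/G²)`. -/
def IsConjInvariant {D : Over S} [IsVar D] (c : D ⟶ G) : Prop :=
  relCls (c ▷ G ≫ (conjIso G).hom) = relCls (c ▷ G)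

lemma IsConjInvariant.commute {D : Over S} [IsVar D] {c : D ⟶ G} (hc : IsConjInvariant c) :
    Commute (conjugation G) (convolution c) := by
  refine end_ext_relCls fun Y _ y => ?_
  -- `m (x, h, t) = h (y t) h⁻¹ x`; conjugating `(y t) (c d)` by `h` gives `m (h (c d) h⁻¹, h, t)`.
  let m : (G ⊗ G) ⊗ Y ⟶ G :=
    (fst _ _ ≫ snd G G) * snd _ _ ≫ y * (fst _ _ ≫ snd G G)⁻¹ * fst _ _ ≫ fst G G
  have hconj : conjugation G (convolution c (relCls y)) =
      relCls ((c ▷ G ≫ (conjIso G).hom) ▷ Y ≫ m) := by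
    rw [convolution_relCls, conjugation_relCls]
    exact relCls_eq_of_iso (α_ Y D G ≪≫ β_ Y (D ⊗ G)) (by
      simp [m, MonObj.comp_mul, GrpObj.comp_inv, conjIso_hom_fst, conjIso_hom_snd,
        _root_.mul_assoc])
  have hconv : convolution c (conjugation G (relCls y)) = relCls ((c ▷ G) ▷ Y ≫ m) := by
    rw [conjugation_relCls, convolution_relCls]
    exact relCls_eq_of_iso (α_ Y G D ≪≫ (Iso.refl Y ⊗ᵢ β_ G D) ≪≫ β_ Y (D ⊗ G)) (by
      simp [m, MonObj.comp_mul, GrpObj.comp_inv, _root_.mul_assoc])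
  exact hconj.trans ((relCls_comp_congr (relCls_whiskerRight_congr hc Y) m).trans hconv.symm)

lemma IsConjInvariant.zpow {D : Over S} [IsVar D] {c : D ⟶ G} (hc : IsConjInvariant c) (n : ℤ) :
    IsConjInvariant (c ^ n) := by
  have hpow : (c ^ n) ▷ G = c ▷ G ≫ ((𝟙 G) ^ n) ▷ G := by
    ext <;> simp [GrpObj.comp_zpow]
  have hcomm : (((𝟙 G) ^ n) ▷ G) ≫ (conjIso G).hom = (conjIso G).hom ≫ ((𝟙 G) ^ n) ▷ G := by
    ext <;> simp [conjIso, GrpObj.comp_zpow, MonObj.comp_mul, GrpObj.comp_inv, conj_zpow]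
  rw [IsConjInvariant, hpow, Category.assoc, hcomm, ← Category.assoc]
  exact relCls_comp_congr hc _

lemma isConjInvariant_commutator : IsConjInvariant (GrpObj.commutator G) := by
  let a : (G ⊗ G) ⊗ G ⟶ G := fst _ _ ≫ fst _ _
  let b : (G ⊗ G) ⊗ G ⟶ G := fst _ _ ≫ snd _ _
  let h : (G ⊗ G) ⊗ G ⟶ G := snd _ _
  refine relCls_eq_of_iso
    ⟨lift (lift (h * a * h⁻¹) (h * b * h⁻¹)) h, lift (lift (h⁻¹ * a * h) (h⁻¹ * b * h)) h,
      ?_, ?_⟩ ?_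
  all_goals
    ext <;> simp [a, b, h, conjIso, GrpObj.commutator, MonObj.comp_mul, GrpObj.comp_inv,
      _root_.mul_assoc]

/-- A subobject `i : X ⟶ G` is stable under conjugation on points with values in reduced varieties.
Other points are left out: if `G` is not reduced, they need not be stable when the rational points
are. -/
def IsConjStable {X : Over S} (i : X ⟶ G) : Prop :=
  ∀ (T : Over S) [IsVar T] [IsReduced T.left] (g : T ⟶ G) (x : T ⟶ X),
    ∃ y : T ⟶ X, y ≫ i = g * (x ≫ i) * g⁻¹

lemma IsConjStable.isConjInvariant {X : Over S} [IsVar X] {i : X ⟶ G} [Mono i]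
    (hi : IsConjStable i) : IsConjInvariant i := by
  have hmono : Mono (i ▷ G) := ⟨fun a b hab => by
    have h1 := hab =≫ fst _ _
    have h2 := hab =≫ snd _ _
    simp only [Category.assoc, whiskerRight_fst, whiskerRight_snd] at h1 h2
    exact CartesianMonoidalCategory.hom_ext _ _
      (by rwa [← cancel_mono i, Category.assoc, Category.assoc]) h2⟩
  have hpoint {T : Over S} (t : T ⟶ G ⊗ G) :
      (∃ a, a ≫ i ▷ G = t) ↔ ∃ x, x ≫ i = t ≫ fst G G := by
    constructor
    · rintro ⟨a, rfl⟩
      exact ⟨a ≫ fst _ _, by simp⟩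
    · rintro ⟨x, hx⟩
      exact ⟨lift x (t ≫ snd _ _), by ext <;> simp [hx]⟩
  refine relCls_eq_of_forall_reduced _ _ fun T _ _ t => ?_
  have hinv : (∃ a, a ≫ i ▷ G ≫ (conjIso G).hom = t) ↔
      ∃ x, x ≫ i = (t ≫ snd G G)⁻¹ * (t ≫ fst G G) * (t ≫ snd G G) := by
    simp only [← Category.assoc, ← Iso.eq_comp_inv, hpoint]
    simp [conjIso, MonObj.comp_mul, GrpObj.comp_inv]
  rw [hinv, hpoint]
  constructor
  · rintro ⟨x, hx⟩
    obtain ⟨y, hy⟩ := hi T (t ≫ snd G G) x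
    exact ⟨y, by rw [hy, hx]; group⟩
  · rintro ⟨x, hx⟩
    obtain ⟨y, hy⟩ := hi T (t ≫ snd G G)⁻¹ x
    exact ⟨y, by rw [hy, hx, inv_inv]⟩

lemma ConjSubvariety.isConjStable_incl {k : Type u} [Field k] [IsAlgClosed k]
    {G : Over (Spec (.of k))} [GrpObj G] (Q : ConjSubvariety G) : IsConjStable Q.incl := by
  intro T hT _ g x
  have : LocallyOfFiniteType T.hom := hT.out.2.1
  refine exists_lift_of_forall_rationalPoint _ _ fun t => ?_
  obtain ⟨y, hy⟩ := Q.conj (t ≫ g) (t ≫ x)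
  exact ⟨y, by simp [hy, MonObj.comp_mul, GrpObj.comp_inv]⟩

end ConjInvariant

/-! ### Discs -/

section Fibre

variable {C : Type*} [Category* C] [CartesianMonoidalCategory C] {G : C} [MonObj G]

lemma isPullback_eta_iff {Y P : C} {y : Y ⟶ G} {p : P ⟶ Y} :
    IsPullback p (toUnit P) y η[G] ↔
      p ≫ y = 1 ∧ ∀ (T : C) (t : T ⟶ Y), t ≫ y = 1 → ∃! a : T ⟶ P, a ≫ p = t := by
  constructor
  · refine fun h => ⟨h.w, fun T t ht => ⟨h.lift t (toUnit T) ht, h.lift_fst _ _ _, ?_⟩⟩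
    exact fun a ha => h.hom_ext (ha.trans (h.lift_fst _ _ _).symm) (toUnit_unique _ _)
  · rintro ⟨hp, h⟩
    have hs (s : PullbackCone y η[G]) : ∃! a : s.pt ⟶ P, a ≫ p = s.fst :=
      h s.pt s.fst (s.condition.trans (congrArg (· ≫ η[G]) (toUnit_unique _ _)))
    choose a ha ha' using hs
    exact IsPullback.of_isLimit' ⟨hp⟩ <| PullbackCone.IsLimit.mk _ a ha
      (fun s => toUnit_unique _ _) fun s m hm _ => ha' s m hm

lemma isPullback_eta_congr {Y P : C} {y y' : Y ⟶ G} {p : P ⟶ Y}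
    (h : ∀ (T : C) (t : T ⟶ Y), t ≫ y = 1 ↔ t ≫ y' = 1)
    (hp : IsPullback p (toUnit P) y η[G]) : IsPullback p (toUnit P) y' η[G] := by
  simpa only [isPullback_eta_iff, h] using hp

end Fibre

section Discs

variable {S : Scheme.{u}} {G : Over S} [GrpObj G] [IsVar G]

lemma zDisc_one : zDisc G 1 = relCls η[G] :=
  (push_relCls (𝟙 (𝟙_ (Over S))) η[G]).trans (congrArg relCls (Category.id_comp _))

lemma zDiscDagger_relCls {Y P : Over S} [IsVar Y] [IsVar P] {y : Y ⟶ G} {p : P ⟶ Y}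
    (h : IsPullback p (toUnit P) y η[G]) : zDiscDagger G (relCls y) = virtualClass P :=
  (pull_relCls h).trans (relCls_toUnit P)

lemma convolution_zDisc_one {D : Over S} [IsVar D] (c : D ⟶ G) :
    convolution c (zDisc G 1) = relCls c := by
  rw [zDisc_one, convolution_relCls]
  refine relCls_eq_of_iso (λ_ D) ?_
  rw [← toUnit_unique (toUnit _) (fst (𝟙_ (Over S)) D), ← Hom.one_def, _root_.one_mul,
    leftUnitor_hom]

lemma zDiscDagger_conjugation (x : K0 G.left) :
    zDiscDagger G (conjugation G x) = virtualClass G * zDiscDagger G x := by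
  suffices h : (zDiscDagger G).comp (conjugation G) =
      (AddMonoidHom.mulLeft (virtualClass G)).comp (zDiscDagger G) from DFunLike.congr_fun h x
  refine addMonoidHom_ext_relCls fun Y _ y => ?_
  have hfibre : IsPullback (pullback.fst y η[G]) (toUnit _) y η[G] := by
    rw [toUnit_unique (toUnit _) (pullback.snd y η[G])]
    exact IsPullback.of_hasPullback y η[G]
  have hprod : IsPullback (pullback.fst y η[G] ▷ G) (toUnit _) (fst Y G ≫ y) η[G] := by
    rw [toUnit_unique (toUnit _) (fst (pullback y η[G]) G ≫ toUnit _)]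
    exact (isPullback_whiskerRight (pullback.fst y η[G]) G).flip.paste_vert hfibre
  have hconj : IsPullback (pullback.fst y η[G] ▷ G) (toUnit _)
      (snd Y G * fst Y G ≫ y * (snd Y G)⁻¹) η[G] :=
    isPullback_eta_congr (fun T t => by
      rw [MonObj.comp_mul, MonObj.comp_mul, GrpObj.comp_inv, conj_eq_one_iff]) hprod
  calc zDiscDagger G (conjugation G (relCls y))
      = virtualClass (pullback y η[G] ⊗ G) := by
        rw [conjugation_relCls, zDiscDagger_relCls hconj]
    _ = virtualClass G * zDiscDagger G (relCls y) := by
        rw [virtualClass_tensor, _root_.mul_comm, zDiscDagger_relCls hfibre]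

lemma zDiscDagger_conjugation_pow (n : ℕ) (x : K0 G.left) :
    zDiscDagger G ((conjugation G ^ n) x) = virtualClass G ^ n * zDiscDagger G x := by
  induction n with
  | zero => simp
  | succ n ih =>
    rw [pow_succ', AddMonoid.End.coe_mul, Function.comp_apply, zDiscDagger_conjugation, ih,
      pow_succ', _root_.mul_assoc]

end Discs

/-! ### Iterated convolutions -/

section FiniteProducts

variable {C : Type*} [Category* C] [CartesianMonoidalCategory C] [HasFiniteProducts C]

/-- The isomorphism `D₀ × ∏ᵢ Dᵢ₊₁ ≅ ∏ᵢ Dᵢ`. -/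
def piSuccIso {n : ℕ} (D : Fin (n + 1) → C) : D 0 ⊗ (∏ᶜ fun i : Fin n => D i.succ) ≅ ∏ᶜ D where
  hom := Pi.lift (Fin.cases (fst _ _) fun i => snd _ _ ≫ Pi.π (fun i : Fin n => D i.succ) i)
  inv := lift (Pi.π D 0) (Pi.lift fun i => Pi.π D i.succ)
  hom_inv_id := by
    ext : 1
    · simp
    · exact Limits.Pi.hom_ext _ _ fun i => by simp
  inv_hom_id := Limits.Pi.hom_ext _ _ (Fin.cases (by simp) fun i => by simp)

lemma piSuccIso_hom_π_zero {n : ℕ} (D : Fin (n + 1) → C) :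
    (piSuccIso D).hom ≫ Pi.π D 0 = fst _ _ := by
  simp [piSuccIso]

lemma piSuccIso_hom_π_succ {n : ℕ} (D : Fin (n + 1) → C) (i : Fin n) :
    (piSuccIso D).hom ≫ Pi.π D i.succ = snd _ _ ≫ Pi.π (fun i : Fin n => D i.succ) i := by
  simp [piSuccIso]

/-- The product `c₀ c₁ ⋯ cₙ₋₁ : ∏ᵢ Dᵢ ⟶ G` of families `cᵢ : Dᵢ ⟶ G`. -/
def piMul {G : C} [MonObj G] {n : ℕ} {D : Fin n → C} (c : ∀ i, D i ⟶ G) : ∏ᶜ D ⟶ G :=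
  (List.ofFn fun i => Pi.π D i ≫ c i).prod

lemma comp_piMul {G : C} [MonObj G] {n : ℕ} {D : Fin n → C} (c : ∀ i, D i ⟶ G) {T : C}
    (t : T ⟶ ∏ᶜ D) : t ≫ piMul c = (List.ofFn fun i => t ≫ Pi.π D i ≫ c i).prod := by
  let φ : (∏ᶜ D ⟶ G) →* (T ⟶ G) :=
    { toFun := (t ≫ ·), map_one' := MonObj.comp_one t, map_mul' := MonObj.comp_mul t }
  exact (map_list_prod φ _).trans (by rw [List.map_ofFn]; rfl)

lemma piSuccIso_hom_piMul {G : C} [MonObj G] {n : ℕ} {D : Fin (n + 1) → C} (c : ∀ i, D i ⟶ G) :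
    (piSuccIso D).hom ≫ piMul c =
      fst _ _ ≫ c 0 * snd _ _ ≫ piMul fun i : Fin n => c i.succ := by
  simp only [comp_piMul, List.ofFn_succ, List.prod_cons, ← Category.assoc, piSuccIso_hom_π_zero,
    piSuccIso_hom_π_succ]

end FiniteProducts

section Iterate

variable {S : Scheme.{u}} {G : Over S} [GrpObj G] [IsVar G]

lemma reverse_prod_convolution {n : ℕ} {D : Fin n → Over S} [∀ i, IsVar (D i)]
    (c : ∀ i, D i ⟶ G) :
    (List.ofFn fun i => convolution (c i)).reverse.prod = convolution (piMul c) := by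
  induction n with
  | zero =>
    have hterminal : IsTerminal (∏ᶜ D) :=
      IsTerminal.ofUniqueHom (fun _ => Pi.lift fun i => i.elim0) fun _ _ =>
        Limits.Pi.hom_ext _ _ fun i => i.elim0
    have hcls : relCls (piMul c) = relCls η[G] :=
      relCls_eq_of_iso (hterminal.uniqueUpToIso isTerminalTensorUnit)
        (by rw [MonObj.one_eq_one, MonObj.comp_one]; simp [piMul])
    rw [convolution_congr hcls, convolution_one]
    simp
  | succ n ih =>
    rw [List.ofFn_succ, List.reverse_cons, List.prod_append, List.prod_singleton,
      ih fun i => c i.succ, convolution_mul_convolution]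
    exact convolution_congr (relCls_eq_of_iso (piSuccIso D) (piSuccIso_hom_piMul c))

end Iterate

/-! ### The representation variety as a fibre -/

lemma zpow_zpow_units {M : Type*} [Group M] (x : M) (e : ℤˣ) : (x ^ (e : ℤ)) ^ (e : ℤ) = x := by
  rw [← zpow_mul, ← Units.val_mul, Int.units_mul_self, Units.val_one, zpow_one]

section HandlePairs

variable {C : Type*} [Category* C] [CartesianMonoidalCategory C] [HasFiniteProducts C]

/-- The projection of the tuples indexed by the generators of the surface group to the pairs
`(aᵢ, bᵢ)`. -/
def handlePairs (G : C) (g s : ℕ) : (∏ᶜ fun _ : SurfaceGen g s => G) ⟶ ∏ᶜ fun _ : Fin g => G ⊗ G :=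
  Pi.lift fun i => lift (Pi.π _ (.a i)) (Pi.π _ (.b i))

lemma comp_handlePairs_eq_iff {G : C} {g s : ℕ} {T : C}
    {p : T ⟶ ∏ᶜ fun _ : SurfaceGen g s => G} {r : T ⟶ ∏ᶜ fun _ : Fin g => G ⊗ G} :
    p ≫ handlePairs G g s = r ↔ ∀ i, p ≫ Pi.π _ (.a i) = r ≫ Pi.π _ i ≫ fst _ _ ∧
      p ≫ Pi.π _ (.b i) = r ≫ Pi.π _ i ≫ snd _ _ := by
  constructor
  · rintro rfl i
    simp [handlePairs]
  · refine fun h => Limits.Pi.hom_ext _ _ fun i => CartesianMonoidalCategory.hom_ext _ _ ?_ ?_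
    · simpa [handlePairs] using (h i).1
    · simpa [handlePairs] using (h i).2

end HandlePairs

section RepVariety

variable {S : Scheme.{u}} {G : Over S} [GrpObj G] {g s : ℕ} {Q : Fin s → ConjSubvariety G}
  {ε : Fin s → ℤˣ}

variable (G g s Q ε) in
/-- The map `((aᵢ, bᵢ)ᵢ, (ξⱼ)ⱼ) ↦ ∏ᵢ [aᵢ, bᵢ] ∏ⱼ ξⱼ ^ εⱼ`, whose fibre over the unit is the
representation variety of the surface. -/
def surfaceMap : (∏ᶜ fun _ : Fin g => G ⊗ G) ⊗ (∏ᶜ fun j => (Q j).obj) ⟶ G :=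
  fst _ _ ≫ piMul (fun _ => GrpObj.commutator G) * snd _ _ ≫ piMul fun j => (Q j).incl ^ (ε j : ℤ)

variable (ε) in
/-- The generators of the surface group, evaluated at a point `t = ((aᵢ, bᵢ)ᵢ, (ξⱼ)ⱼ)`. As `εⱼ` is
its own inverse, `cⱼ = ξⱼ ^ εⱼ` has the meridian `cⱼ ^ εⱼ = ξⱼ`. -/
def surfaceTuple {T : Over S} (t : T ⟶ (∏ᶜ fun _ : Fin g => G ⊗ G) ⊗ (∏ᶜ fun j => (Q j).obj)) :
    SurfaceGen g s → (T ⟶ G)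
  | .a i => t ≫ fst _ _ ≫ Pi.π _ i ≫ fst _ _
  | .b i => t ≫ fst _ _ ≫ Pi.π _ i ≫ snd _ _
  | .c j => (t ≫ snd _ _ ≫ Pi.π _ j ≫ (Q j).incl) ^ (ε j : ℤ)

lemma comp_surfaceMap {T : Over S}
    (t : T ⟶ (∏ᶜ fun _ : Fin g => G ⊗ G) ⊗ (∏ᶜ fun j => (Q j).obj)) :
    t ≫ surfaceMap G g s Q ε = FreeGroup.lift (surfaceTuple ε t) (surfaceRelator g s) := by
  rw [surfaceMap, MonObj.comp_mul, ← Category.assoc, ← Category.assoc, comp_piMul, comp_piMul]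
  simp [surfaceRelator, surfaceTuple, Function.comp_def, GrpObj.commutator, map_list_prod,
    List.map_ofFn, MonObj.comp_mul, GrpObj.comp_inv, GrpObj.comp_zpow]

lemma eq_lift_surfaceTuple_iff {T : Over S} {p : T ⟶ ∏ᶜ fun _ : SurfaceGen g s => G}
    {t : T ⟶ (∏ᶜ fun _ : Fin g => G ⊗ G) ⊗ (∏ᶜ fun j => (Q j).obj)} :
    p = Pi.lift (surfaceTuple ε t) ↔ p ≫ handlePairs G g s = t ≫ fst _ _ ∧
      ∀ j, (p ≫ Pi.π _ (.c j)) ^ (ε j : ℤ) = (t ≫ snd _ _) ≫ Pi.π _ j ≫ (Q j).incl := by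
  rw [comp_handlePairs_eq_iff]
  constructor
  · rintro rfl
    simp [surfaceTuple, zpow_zpow_units]
  · rintro ⟨hab, hc⟩
    refine Limits.Pi.hom_ext _ _ fun i => ?_
    rw [Pi.lift_π]
    cases i with
    | a i => simpa [surfaceTuple] using (hab i).1
    | b i => simpa [surfaceTuple] using (hab i).2
    | c j => rw [← zpow_zpow_units (p ≫ _) (ε j), hc]; simp [surfaceTuple]

lemma comp_handlePairs_and_comp_wordMap_iff {T : Over S} {p : T ⟶ ∏ᶜ fun _ : SurfaceGen g s => G}
    {t : T ⟶ (∏ᶜ fun _ : Fin g => G ⊗ G) ⊗ (∏ᶜ fun j => (Q j).obj)} :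
    p ≫ handlePairs G g s = t ≫ fst _ _ ∧
        p ≫ wordMap G (fun _ : Unit => surfaceRelator g s) (meridian ε) =
          (t ≫ snd _ _) ≫ dataMap G Unit Q ↔
      p = Pi.lift (surfaceTuple ε t) ∧ t ≫ surfaceMap G g s Q ε = 1 := by
  have htuple := eq_lift_surfaceTuple_iff (p := p) (t := t) (ε := ε)
  rw [comp_wordMap_eq_iff, comp_surfaceMap]
  simp only [meridian, map_zpow, FreeGroup.lift_apply_of, Category.assoc] at htuple ⊢
  constructor
  · rintro ⟨hpairs, hrel, hdata⟩
    obtain rfl := htuple.2 ⟨hpairs, hdata⟩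
    exact ⟨rfl, by simpa using hrel ()⟩
  · rintro ⟨hp, hrel⟩
    refine ⟨(htuple.1 hp).1, fun _ => ?_, (htuple.1 hp).2⟩
    simpa [hp] using hrel

variable (G g s Q ε) in
/-- The map `ρ ↦ ((ρ aᵢ, ρ bᵢ)ᵢ, (ρ cⱼ ^ εⱼ)ⱼ)` on the representation variety of the surface. -/
def SurfaceRepVariety.toProduct :
    RepVariety G (fun _ : Unit => surfaceRelator g s) (meridian ε) Q ⟶
      (∏ᶜ fun _ : Fin g => G ⊗ G) ⊗ (∏ᶜ fun j => (Q j).obj) :=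
  lift (RepVariety.emb G (fun _ : Unit => surfaceRelator g s) (meridian ε) Q ≫ handlePairs G g s)
    (pullback.snd _ _)

variable (G g s Q ε) in
lemma SurfaceRepVariety.isPullback :
    IsPullback (toProduct G g s Q ε) (toUnit _) (surfaceMap G g s Q ε) η[G] := by
  have hpoint {T : Over S}
      (a : T ⟶ RepVariety G (fun _ : Unit => surfaceRelator g s) (meridian ε) Q) :
      a ≫ RepVariety.emb G _ _ Q =
          Pi.lift (surfaceTuple ε (a ≫ toProduct G g s Q ε)) ∧
        (a ≫ toProduct G g s Q ε) ≫ surfaceMap G g s Q ε = 1 :=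
    comp_handlePairs_and_comp_wordMap_iff.1 ⟨by simp [toProduct], by
      simpa [toProduct] using a ≫= pullback.condition⟩
  refine isPullback_eta_iff.2 ⟨?_, fun T t ht => ?_⟩
  · simpa using (hpoint (𝟙 _)).2
  · obtain ⟨hpairs, hword⟩ := comp_handlePairs_and_comp_wordMap_iff.2 ⟨rfl, ht⟩
    obtain ⟨a, ha, ha'⟩ : ∃ a : T ⟶ RepVariety G (fun _ : Unit => surfaceRelator g s) _ Q,
        a ≫ pullback.fst _ _ = Pi.lift (surfaceTuple ε t) ∧ a ≫ pullback.snd _ _ = t ≫ snd _ _ :=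
      ⟨pullback.lift _ _ hword, pullback.lift_fst _ _ hword, pullback.lift_snd _ _ hword⟩
    refine ⟨a, ?_, fun b hb => pullback.hom_ext ?_ ?_⟩
    · ext : 1
      · simpa [toProduct, reassoc_of% ha] using hpairs
      · simpa [toProduct] using ha'
    · rw [ha, ← hb]
      exact (hpoint b).1
    · rw [ha', ← hb]
      simp [toProduct]

end RepVariety

/-! ### The surface operator -/

lemma commute_prod_reverse_ofFn {M : Type*} [Monoid M] {a : M} {n : ℕ} {x : Fin n → M}
    (h : ∀ i, Commute a (x i)) : Commute a (List.ofFn x).reverse.prod :=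
  Commute.list_prod_right _ _ fun y hy => by
    obtain ⟨i, rfl⟩ := List.mem_ofFn.1 (List.mem_reverse.1 hy)
    exact h i

lemma prod_reverse_ofFn_mul_left {M : Type*} [Monoid M] {a : M} {n : ℕ} {x : Fin n → M}
    (h : ∀ i, Commute a (x i)) :
    (List.ofFn fun i => a * x i).reverse.prod = a ^ n * (List.ofFn x).reverse.prod := by
  induction n with
  | zero => simp
  | succ n ih =>
    have hcomm := commute_prod_reverse_ofFn fun i : Fin n => h i.succ
    simp only [List.ofFn_succ, List.reverse_cons, List.prod_append, List.prod_singleton,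
      ih fun i => h i.succ]
    rw [pow_succ, _root_.mul_assoc, _root_.mul_assoc, hcomm.symm.left_comm]

lemma convolution_pow {S : Scheme.{u}} {G : Over S} [GrpObj G] [IsVar G] {D : Over S} [IsVar D]
    (c : D ⟶ G) (n : ℕ) : convolution c ^ n = convolution (piMul fun _ : Fin n => c) := by
  rw [← reverse_prod_convolution, List.ofFn_const, List.reverse_replicate, List.prod_replicate]

lemma algebraMap_away_eq_invSelf_pow_mul {R : Type*} [CommRing R] {a x y : R} {n : ℕ}
    (h : a ^ n * x = y) :
    algebraMap R (Localization.Away a) x =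
      IsLocalization.Away.invSelf a ^ n * algebraMap R (Localization.Away a) y := by
  rw [← h, map_mul, map_pow, ← _root_.mul_assoc, ← mul_pow,
    _root_.mul_comm (IsLocalization.Away.invSelf a), IsLocalization.Away.mul_invSelf, one_pow,
    _root_.one_mul]

section Surface

variable {S : Scheme.{u}} (G : Over S) [GrpObj G] [IsVar G] (g s : ℕ)
  {Q : Fin s → ConjSubvariety G} (ε : Fin s → ℤˣ) (hQ : ∀ j, IsConjStable (Q j).incl)

include hQ

lemma reverse_prod_zTube_mul_zHoledTorus_pow :
    (List.ofFn fun j => zTube G (Q j) (ε j)).reverse.prod * zHoledTorus G ^ g =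
      conjugation G ^ (g + s) * convolution (surfaceMap G g s Q ε) := by
  have hcomm (j : Fin s) : Commute (conjugation G) (convolution ((Q j).incl ^ (ε j : ℤ))) :=
    have := mono_of_mono_left (Q j).incl
    ((hQ j).isConjInvariant.zpow _).commute
  have htubes : (List.ofFn fun j => zTube G (Q j) (ε j)).reverse.prod =
      conjugation G ^ s * convolution (piMul fun j => (Q j).incl ^ (ε j : ℤ)) := by
    simp only [zTube_eq, prod_reverse_ofFn_mul_left hcomm, reverse_prod_convolution]
  have htori : zHoledTorus G ^ g =
      conjugation G ^ g * convolution (piMul fun _ : Fin g => GrpObj.commutator G) := by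
    rw [zHoledTorus_eq, isConjInvariant_commutator.commute.mul_pow, convolution_pow]
  have hcomm' : Commute (conjugation G ^ g) (convolution (piMul fun j => (Q j).incl ^ (ε j : ℤ))) :=
    reverse_prod_convolution (fun j => (Q j).incl ^ (ε j : ℤ)) ▸
      (commute_prod_reverse_ofFn hcomm).pow_left g
  rw [htubes, htori, surfaceMap, ← convolution_mul_convolution, _root_.mul_assoc,
    hcomm'.symm.left_comm, ← _root_.mul_assoc, ← pow_add, add_comm s g]

lemma zSurface_one : zSurface G g s Q ε 1 =
    virtualClass G ^ (g + s) * virtualClass (SurfaceRepVariety G g s Q ε) :=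
  calc zSurface G g s Q ε 1
      = zDiscDagger G ((conjugation G ^ (g + s)) (convolution (surfaceMap G g s Q ε)
          (zDisc G 1))) :=
        congrArg (fun φ : AddMonoid.End (K0 G.left) => zDiscDagger G (φ (zDisc G 1)))
          (reverse_prod_zTube_mul_zHoledTorus_pow G g s ε hQ)
    _ = virtualClass G ^ (g + s) * zDiscDagger G (relCls (surfaceMap G g s Q ε)) := by
        rw [zDiscDagger_conjugation_pow, convolution_zDisc_one]
    _ = virtualClass G ^ (g + s) * virtualClass (SurfaceRepVariety G g s Q ε) :=
        congrArg _ (zDiscDagger_relCls (SurfaceRepVariety.isPullback G g s Q ε))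

end Surface

end RepTQFT

end

theorem mainTheorem6_general {S : Scheme.{u}} (G : Over S) [GrpObj G] [RepTQFT.IsVar G]
    (g s : ℕ) (Q : Fin s → RepTQFT.ConjSubvariety G) (ε : Fin s → ℤˣ)
    (hQ : ∀ j, RepTQFT.IsConjStable (Q j).incl) :
    RepTQFT.virtualClass G ^ (g + s) *
          RepTQFT.virtualClass (RepTQFT.SurfaceRepVariety G g s Q ε) =
        RepTQFT.zSurface G g s Q ε 1 ∧
      algebraMap (RepTQFT.K0 S) (Localization.Away (RepTQFT.virtualClass G))
          (RepTQFT.virtualClass (RepTQFT.SurfaceRepVariety G g s Q ε)) =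
        IsLocalization.Away.invSelf (RepTQFT.virtualClass G) ^ (g + s) *
          algebraMap (RepTQFT.K0 S) (Localization.Away (RepTQFT.virtualClass G))
            (RepTQFT.zSurface G g s Q ε 1) := by
  have hclass := (RepTQFT.zSurface_one G g s ε hQ).symm
  exact ⟨hclass, RepTQFT.algebraMap_away_eq_invSelf_pow_mul hclass⟩

theorem mainTheorem6 {k : Type u} [Field k] [IsAlgClosed k] (G : Over (Spec (.of k))) [GrpObj G]
    [RepTQFT.IsVar G] [IsReduced G.left] (g s : ℕ) (Q : Fin s → RepTQFT.ConjSubvariety G)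
    (ε : Fin s → ℤˣ) :
    RepTQFT.virtualClass G ^ (g + s) *
          RepTQFT.virtualClass (RepTQFT.SurfaceRepVariety G g s Q ε) =
        RepTQFT.zSurface G g s Q ε 1 ∧
      algebraMap (RepTQFT.K0 (Spec (.of k))) (Localization.Away (RepTQFT.virtualClass G))
          (RepTQFT.virtualClass (RepTQFT.SurfaceRepVariety G g s Q ε)) =
        IsLocalization.Away.invSelf (RepTQFT.virtualClass G) ^ (g + s) *
          algebraMap (RepTQFT.K0 (Spec (.of k))) (Localization.Away (RepTQFT.virtualClass G))
            (RepTQFT.zSurface G g s Q ε 1) :=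
  mainTheorem6_general G g s Q ε fun j => (Q j).isConjStable_incl
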